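/- Let $p$ be a prime, let $n$ be a positive integer with $n\ge 2$ if $p=2$, and let $k\ge 0$. Let $K/F$ be a Galois extension of fields whose group $G=\mathrm{Gal}(K/F)$ is isomorphic to $\mathbb{Z}/p^n\mathbb{Z}$. Let $L/K$ be an elementary $p$-abelian extension (Galois, with abelian Galois group of exponent dividing $p$) such that $L/F$ is Galois. Let $J$ be the space that parametrizes the elementary $p$-abelian extensions of $K$, and let $N\subseteq J$ be the $\mathbb{F}_p[G]$-submodule corresponding to $L$; that is: (i) if $K$ contains a primitive $p$-th root of unity, then $J=K^\times/K^{\times p}$ with the natural $G$-action, and $L=K(\sqrt[p]{\gamma}:\gamma\in N)$; (ii) if $\mathrm{char}\,K\ne p$ (whether or not $K$ contains a primitive $p$-th root of unity $\xi_p$), put $E=K(\xi_p)$; then $J\subseteq E^\times/E^{\times p}$ consists of the classes $\gamma$ such that $\varepsilon(\gamma)=\gamma^{t}$ whenever $\varepsilon\in\mathrm{Gal}(E/K)$ and $\varepsilon(\zeta)=\zeta^t$ for all $p$-th roots of unity $\zeta$; an element $g\in G$ acts on $J$ through the unique extension of $g$ to an automorphism of $E$ that fixes the $p$-th roots of unity;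 and $L(\xi_p)=E(\sqrt[p]{\gamma}:\gamma\in N)$; (iii) if $\mathrm{char}\,K=p$, then $J=K/\wp(K)$, where $\wp(K)=\{x^p-x: x\in K\}$, with the natural $G$-action, and $L=K(\rho(\gamma):\gamma\in N)$, where $\rho(\gamma)$ is a root of $X^p-X-\gamma$. In each of these settings, if $N\cong\mathbb{F}_p[G]^k$ as $\mathbb{F}_p[G]$-modules, then $\mathrm{Gal}(L/F)\cong\mathbb{F}_p[G]^k\rtimes G$, where $G$ acts on $\mathbb{F}_p[G]^k$ by left multiplication in each coordinate. -/

import Mathlib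

open scoped MonoidAlgebra

noncomputable section

/-- `L / K` is an elementary `p`-abelian extension: it is Galois, and its Galois group is abelian
of exponent dividing `p`. -/
structure IsElementaryAbelianExt (p : ℕ) (K L : Type*) [Field K] [Field L] [Algebra K L] :
    Prop where
  isGalois : IsGalois K L
  comm : ∀ s t : Gal(L/K), s * t = t * s
  pow_eq_one : ∀ s : Gal(L/K), s ^ p = 1

/-! ### The semidirect product `𝔽_p[G]^k ⋊ G` -/

/-- `G` acts on `𝔽_p[G]^k` by left multiplication in each coordinate. -/
def freeModuleAction (p k : ℕ) (G : Type*) [Group G] :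
    G →* MulAut (Multiplicative (Fin k → (ZMod p)[G])) where
  toFun g := AddEquiv.toMultiplicative
    { toFun := fun v i => MonoidAlgebra.of (ZMod p) G g * v i
      invFun := fun v i => MonoidAlgebra.of (ZMod p) G g⁻¹ * v i
      left_inv := fun v => by
        funext i
        dsimp only
        rw [← mul_assoc, ← map_mul, inv_mul_cancel, map_one, one_mul]
      right_inv := fun v => by
        funext i
        dsimp only
        rw [← mul_assoc, ← map_mul, mul_inv_cancel, map_one, one_mul]
      map_add' := fun v w => by
        funext i
        simp only [Pi.add_apply, mul_add] }
  map_one' := by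
    refine MulEquiv.ext fun v => ?_
    apply Multiplicative.toAdd.injective
    funext i
    exact (congrArg (· * v.toAdd i) (map_one (MonoidAlgebra.of (ZMod p) G))).trans (one_mul _)
  map_mul' g h := by
    refine MulEquiv.ext fun v => ?_
    apply Multiplicative.toAdd.injective
    funext i
    exact (congrArg (· * v.toAdd i) (map_mul (MonoidAlgebra.of (ZMod p) G) g h)).trans
      (mul_assoc _ _ _)

/-- The group `𝔽_p[G]^k ⋊ G`. -/
abbrev FreeSemidirect (p k : ℕ) (G : Type*) [Group G] : Type _ :=
  Multiplicative (Fin k → (ZMod p)[G]) ⋊[freeModuleAction p k G] G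

/-! ### Characteristic `p`: the space `K / ℘(K)` -/

section ArtinSchreier

variable (p : ℕ) [Fact p.Prime]

/-- The additive map `x ↦ x ^ p - x` on a field of characteristic `p`. -/
def wp (K : Type*) [Field K] [CharP K p] : K →+ K where
  toFun x := x ^ p - x
  map_zero' := by simp [(Fact.out : p.Prime).ne_zero]
  map_add' x y := by rw [add_pow_char]; ring

/-- `K / ℘(K)`. -/
abbrev ASClasses (K : Type*) [Field K] [CharP K p] : Type _ := K ⧸ (wp p K).range

instance ASClasses.module (K : Type*) [Field K] [CharP K p] : Module (ZMod p) (ASClasses p K) :=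
  QuotientAddGroup.zmodModule fun x => by
    rw [nsmul_eq_mul, CharP.cast_eq_zero, zero_mul]; exact zero_mem _

/-- The action of `Gal(K/F)` on `K / ℘(K)`. -/
def asRep (F K : Type*) [Field F] [Field K] [Algebra F K] [CharP K p] :
    Representation (ZMod p) Gal(K/F) (ASClasses p K) where
  toFun g := AddMonoidHom.toZModLinearMap p <|
    QuotientAddGroup.map (wp p K).range (wp p K).range (g : K →+ K) <| by
      rintro _ ⟨x, rfl⟩
      exact ⟨g x, by simp [wp]⟩
  map_one' := by
    ext x
    induction x using QuotientAddGroup.induction_on with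
    | H x => rfl
  map_mul' g h := by
    ext x
    induction x using QuotientAddGroup.induction_on with
    | H x => rfl

/-- `L = K(ρ(γ) : γ ∈ S)`, where `ρ(γ)` is a root of `X ^ p - X - γ`. -/
def IsASExtOf {K : Type*} (L : Type*) [Field K] [Field L] [Algebra K L] [CharP K p]
    (S : Set (ASClasses p K)) : Prop :=
  (∀ a : K, (QuotientAddGroup.mk a : ASClasses p K) ∈ S →
    ∃ x : L, x ^ p - x = algebraMap K L a) ∧
  IntermediateField.adjoin K {x : L | ∃ a : K, (QuotientAddGroup.mk a : ASClasses p K) ∈ S ∧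
    x ^ p - x = algebraMap K L a} = ⊤

end ArtinSchreier

/-! ### Characteristic different from `p`: the space `E^× / E^{×p}` -/

section Kummer

variable (p : ℕ)

/-- `E^× / E^{×p}`, written additively. -/
def PowerClasses (E : Type*) [Field E] : Type _ :=
  Additive (Eˣ ⧸ (powMonoidHom p : Eˣ →* Eˣ).range)

instance PowerClasses.addCommGroup (E : Type*) [Field E] : AddCommGroup (PowerClasses p E) :=
  inferInstanceAs (AddCommGroup (Additive (Eˣ ⧸ (powMonoidHom p : Eˣ →* Eˣ).range)))

/-- The class of a unit in `E^× / E^{×p}`. -/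
def PowerClasses.mk {E : Type*} [Field E] (u : Eˣ) : PowerClasses p E :=
  Additive.ofMul (QuotientGroup.mk u : Eˣ ⧸ (powMonoidHom p : Eˣ →* Eˣ).range)

theorem PowerClasses.mk_surjective {E : Type*} [Field E] (γ : PowerClasses p E) :
    ∃ u : Eˣ, PowerClasses.mk p u = γ :=
  QuotientGroup.mk_surjective (s := (powMonoidHom p : Eˣ →* Eˣ).range) γ

instance PowerClasses.module (E : Type*) [Field E] : Module (ZMod p) (PowerClasses p E) :=
  AddCommGroup.zmodModule fun x => by
    obtain ⟨u, rfl⟩ := PowerClasses.mk_surjective p x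
    exact (QuotientGroup.eq_one_iff (N := (powMonoidHom p : Eˣ →* Eˣ).range) (u ^ p)).2 ⟨u, rfl⟩

/-- The map on `E^× / E^{×p}` induced by an element of `Gal(E/F)`. -/
def powerMap (F E : Type*) [Field F] [Field E] [Algebra F E] (g : Gal(E/F)) :
    PowerClasses p E →+ PowerClasses p E :=
  MonoidHom.toAdditive <|
    QuotientGroup.map (powMonoidHom p : Eˣ →* Eˣ).range (powMonoidHom p : Eˣ →* Eˣ).range
      (Units.map (g : E →* E)) <| by
        rintro _ ⟨x, rfl⟩
        exact ⟨Units.map (g : E →* E) x, by simp⟩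

/-- The action of `Gal(E/F)` on `E^× / E^{×p}`. -/
def powerRep (F E : Type*) [Field F] [Field E] [Algebra F E] :
    Representation (ZMod p) Gal(E/F) (PowerClasses p E) where
  toFun g := AddMonoidHom.toZModLinearMap p (powerMap p F E g)
  map_one' := by
    ext x
    obtain ⟨u, rfl⟩ := PowerClasses.mk_surjective p x
    rfl
  map_mul' g h := by
    ext x
    obtain ⟨u, rfl⟩ := PowerClasses.mk_surjective p x
    rfl

theorem powerRep_mk {F E : Type*} [Field F] [Field E] [Algebra F E] (g : Gal(E/F)) (u : Eˣ) :
    powerRep p F E g (PowerClasses.mk p u) = PowerClasses.mk p (Units.map (g : E →* E) u) := rfl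

/-- `M = E(γ^{1/p} : γ ∈ S)`. -/
def IsKummerExtOf {E : Type*} (M : Type*) [Field E] [Field M] [Algebra E M]
    (S : Set (PowerClasses p E)) : Prop :=
  (∀ u : Eˣ, PowerClasses.mk p u ∈ S → ∃ x : M, x ^ p = algebraMap E M u) ∧
  IntermediateField.adjoin E {x : M | ∃ u : Eˣ, PowerClasses.mk p u ∈ S ∧
    x ^ p = algebraMap E M u} = ⊤

/-- For `E = K(ξ_p)`, the subspace of `E^× / E^{×p}` which parametrizes the elementary `p`-abelian
extensions of `K`: the classes `γ` such that `ε(γ) = γ ^ t` whenever `ε ∈ Gal(E/K)` acts on the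
`p`-th roots of unity by `ζ ↦ ζ ^ t`. It is everything if `ξ_p ∈ K`. -/
def cycSpace (K E : Type*) [Field K] [Field E] [Algebra K E] :
    Submodule (ZMod p) (PowerClasses p E) where
  carrier := {γ | ∀ (ε : Gal(E/K)) (t : ℕ), (∀ ζ : E, ζ ^ p = 1 → ε ζ = ζ ^ t) →
    powerRep p K E ε γ = (t : ZMod p) • γ}
  add_mem' := fun ha hb ε t h => by rw [map_add, ha ε t h, hb ε t h, smul_add]
  zero_mem' := fun ε t _ => by rw [map_zero, smul_zero]
  smul_mem' := fun c x hx ε t h => by rw [map_smul, hx ε t h, smul_comm]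

variable [Fact p.Prime] {n : ℕ} {F K : Type*} (E : Type*) [Field F] [Field K] [Field E]
  [Algebra F K] [Algebra F E] [Algebra K E]

/-- `h ∈ Gal(E/F)` extends `g ∈ Gal(K/F)` and fixes the `p`-th roots of unity. -/
def ExtendsFixingRoots (g : Gal(K/F)) (h : Gal(E/F)) : Prop :=
  (∀ x : K, h (algebraMap K E x) = algebraMap K E (g x)) ∧ ∀ ζ : E, ζ ^ p = 1 → h ζ = ζ

variable {E} in
theorem ExtendsFixingRoots.unique [IsCyclotomicExtension {p} K E] {g : Gal(K/F)} {h h' : Gal(E/F)}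
    (H : ExtendsFixingRoots p E g h) (H' : ExtendsFixingRoots p E g h') : h = h' := by
  ext x
  have hx := IsCyclotomicExtension.adjoin_roots (S := {p}) (A := K) (B := E) x
  induction hx using Algebra.adjoin_induction with
  | mem y hy =>
    obtain ⟨m, hm, -, hy⟩ := hy
    rw [Set.mem_singleton_iff] at hm
    subst hm
    rw [H.2 y hy, H'.2 y hy]
  | algebraMap r => rw [H.1, H'.1]
  | add a b _ _ ha hb => rw [map_add, map_add, ha, hb]
  | mul a b _ _ ha hb => rw [map_mul, map_mul, ha, hb]

variable [IsScalarTower F K E]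

theorem exists_extendsFixingRoots [FiniteDimensional F K] [IsGalois F K]
    [IsCyclotomicExtension {p} K E]
    (hG : Nonempty (Gal(K/F) ≃* Multiplicative (ZMod (p ^ n)))) (g : Gal(K/F)) :
    ∃ h : Gal(E/F), ExtendsFixingRoots p E g h := by
  have hp : p.Prime := Fact.out
  have : NeZero p := ⟨hp.ne_zero⟩
  obtain ⟨ζ₀, hζ₀⟩ := IsCyclotomicExtension.exists_isPrimitiveRoot (S := {p}) K E
    (Set.mem_singleton p) hp.ne_zero
  -- `E / F` is normal
  obtain ⟨f, hf0, hf⟩ : ∃ f : Polynomial F, f ≠ 0 ∧ Polynomial.IsSplittingField F K f := by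
    obtain ⟨f, hf⟩ := Normal.exists_isSplittingField F K
    by_cases hf0 : f = 0
    · refine ⟨1, one_ne_zero, ⟨by simp, ?_⟩⟩
      have := hf.adjoin_rootSet
      rw [hf0] at this
      simpa using this
    · exact ⟨f, hf0, hf⟩
  have : Polynomial.IsSplittingField K E
      (((Polynomial.X : Polynomial F) ^ p - 1).map (algebraMap F K)) := by
    have := IsCyclotomicExtension.isSplittingField_X_pow_sub_one p K E
    simpa using this
  have hsp := Polynomial.IsSplittingField.mul (K := K) E f
    ((Polynomial.X : Polynomial F) ^ p - 1) hf0
    (Polynomial.X_pow_sub_C_ne_zero hp.pos 1)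
  have : Normal F E := Normal.of_isSplittingField (f * (Polynomial.X ^ p - 1))
  -- correct an arbitrary extension of `g` by a suitable power
  have hco : Nat.Coprime (p ^ n) (p - 1) := by
    apply Nat.Coprime.pow_left
    rw [Nat.Prime.coprime_iff_not_dvd hp]
    intro hd
    have := hp.two_le
    have := Nat.le_of_dvd (by omega) hd
    omega
  obtain ⟨m, hm1, hm2⟩ := Nat.chineseRemainder hco 1 0
  have hgord : g ^ (p ^ n) = 1 := by
    obtain ⟨e⟩ := hG
    apply e.injective
    rw [map_pow, map_one]
    apply Multiplicative.toAdd.injective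
    rw [toAdd_pow, toAdd_one, nsmul_eq_mul, CharP.cast_eq_zero, zero_mul]
  have hgm : g ^ m = g := by
    have := pow_eq_pow_iff_modEq.2 (hm1.of_dvd (orderOf_dvd_of_pow_eq_one hgord))
    rwa [pow_one] at this
  set h := AlgEquiv.liftNormal g E with hh
  have hpow : ∀ (j : ℕ) (x : K), (h ^ j) (algebraMap K E x) = algebraMap K E ((g ^ j) x) := by
    intro j
    induction j with
    | zero => intro x; rfl
    | succ j ih =>
      intro x
      rw [pow_succ, pow_succ, AlgEquiv.mul_apply, AlgEquiv.mul_apply, hh,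
        AlgEquiv.liftNormal_commutes, ← hh, ih]
  refine ⟨h ^ m, fun x => by rw [hpow, hgm], fun ζ hζ => ?_⟩
  obtain ⟨i, -, hi⟩ := hζ₀.eq_pow_of_pow_eq_one (ξ := h ζ₀) (by
    rw [← map_pow, hζ₀.pow_eq_one, map_one])
  have hact : ∀ (j : ℕ) (ζ : E), ζ ^ p = 1 → (h ^ j) ζ = ζ ^ (i ^ j) := by
    intro j
    induction j with
    | zero => intro ζ _; rw [pow_zero, pow_zero, pow_one]; rfl
    | succ j ih =>
      intro ζ hζ
      obtain ⟨l, -, rfl⟩ := hζ₀.eq_pow_of_pow_eq_one hζ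
      rw [pow_succ, AlgEquiv.mul_apply, map_pow, ← hi, map_pow, map_pow, ih ζ₀ hζ₀.pow_eq_one]
      simp only [← pow_mul]
      ring_nf
  rw [hact m ζ hζ]
  have hpi : ¬ p ∣ i := by
    rintro ⟨c, rfl⟩
    rw [pow_mul, hζ₀.pow_eq_one, one_pow] at hi
    have h1 : ζ₀ = 1 := h.injective (by rw [← hi, map_one])
    exact hζ₀.ne_one hp.one_lt h1
  obtain ⟨c, rfl⟩ := (Nat.modEq_zero_iff_dvd).1 hm2
  have hfer : i ^ ((p - 1) * c) ≡ 1 [MOD p] := by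
    have := Nat.ModEq.pow_totient ((Nat.Prime.coprime_iff_not_dvd hp).2 hpi).symm
    rw [Nat.totient_prime hp] at this
    simpa [pow_mul] using this.pow c
  rw [pow_eq_pow_mod _ hζ, hfer, ← pow_eq_pow_mod _ hζ, pow_one]

/-- The extension of the action of `Gal(K/F)` to `E = K(ξ_p)`: each `g` acts on `E` by the unique
extension of `g` that fixes the `p`-th roots of unity. -/
def cycLift [FiniteDimensional F K] [IsGalois F K] [IsCyclotomicExtension {p} K E]
    (hG : Nonempty (Gal(K/F) ≃* Multiplicative (ZMod (p ^ n)))) : Gal(K/F) →* Gal(E/F) where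
  toFun g := (exists_extendsFixingRoots p E hG g).choose
  map_one' := (exists_extendsFixingRoots p E hG 1).choose_spec.unique p
    ⟨fun _ => rfl, fun _ _ => rfl⟩
  map_mul' g g' := by
    have h := (exists_extendsFixingRoots p E hG g).choose_spec
    have h' := (exists_extendsFixingRoots p E hG g').choose_spec
    refine (exists_extendsFixingRoots p E hG (g * g')).choose_spec.unique p ⟨fun x => ?_, ?_⟩
    · rw [AlgEquiv.mul_apply, h'.1, h.1, AlgEquiv.mul_apply]
    · intro ζ hζ
      rw [AlgEquiv.mul_apply, h'.2 ζ hζ, h.2 ζ hζ]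

theorem cycLift_spec [FiniteDimensional F K] [IsGalois F K] [IsCyclotomicExtension {p} K E]
    (hG : Nonempty (Gal(K/F) ≃* Multiplicative (ZMod (p ^ n)))) (g : Gal(K/F)) :
    ExtendsFixingRoots p E g (cycLift p E hG g) :=
  (exists_extendsFixingRoots p E hG g).choose_spec

theorem cycSpace_stable [FiniteDimensional F K] [IsGalois F K] [IsCyclotomicExtension {p} K E]
    (hG : Nonempty (Gal(K/F) ≃* Multiplicative (ZMod (p ^ n)))) (g : Gal(K/F)) :
    cycSpace p K E ≤ (cycSpace p K E).comap ((powerRep p F E).comp (cycLift p E hG) g) := by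
  intro γ hγ ε t ht
  obtain ⟨h1, h2⟩ := cycLift_spec p E hG g
  set h := cycLift p E hG g with hh
  have h1' : ∀ x : K, h.symm (algebraMap K E x) = algebraMap K E (g.symm x) := fun x => by
    rw [AlgEquiv.symm_apply_eq, h1, AlgEquiv.apply_symm_apply]
  have h2' : ∀ ζ : E, ζ ^ p = 1 → h.symm ζ = ζ := fun ζ hζ => by
    rw [AlgEquiv.symm_apply_eq, h2 ζ hζ]
  let ε' : Gal(E/K) := AlgEquiv.ofRingEquiv
    (f := ((h : E ≃+* E).trans (ε : E ≃+* E)).trans (h.symm : E ≃+* E)) (fun x => by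
      change h.symm (ε (h (algebraMap K E x))) = _
      rw [h1, AlgEquiv.commutes, h1', AlgEquiv.symm_apply_apply])
  have he : ∀ x, h (ε' x) = ε (h x) := fun x => h.apply_symm_apply _
  have key := hγ ε' t (fun ζ hζ => by
    change h.symm (ε (h ζ)) = _
    rw [h2 ζ hζ, ht ζ hζ, h2']
    rw [← pow_mul, mul_comm, pow_mul, hζ, one_pow])
  change powerRep p K E ε (powerRep p F E h γ) = (t : ZMod p) • powerRep p F E h γ
  rw [← map_smul, ← key]
  obtain ⟨u, rfl⟩ := PowerClasses.mk_surjective p γ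
  simp only [powerRep_mk]
  congr 1
  ext
  exact (he u).symm

/-- The action of `Gal(K/F)` on the parametrizing space `cycSpace p K E`, where `E = K(ξ_p)`. -/
def cycRep [FiniteDimensional F K] [IsGalois F K] [IsCyclotomicExtension {p} K E]
    (hG : Nonempty (Gal(K/F) ≃* Multiplicative (ZMod (p ^ n)))) :
    Representation (ZMod p) Gal(K/F) (cycSpace p K E) :=
  Representation.subrepresentation ((powerRep p F E).comp (cycLift p E hG)) (cycSpace p K E)
    (cycSpace_stable p E hG)

end Kummer

end

/-! Let `Γ = Gal(L/F)`, with restriction map `π` onto `G` and kernel `A = Gal(L/K)`. If `x` is a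
root attached to `γ ∈ N`, then `(σ, γ) ↦ σ(x) - x` (in Kummer theory `σ(x) / x`) is a pairing of `A`
with `N` with values in a group of order `p`. It is nondegenerate in `σ` because the roots generate
the extension, and in `γ` because a root fixed by `A` lies in the base field. Since `Γ` acts
trivially on the values, `⟨τστ⁻¹, π(τ)γ⟩ = ⟨σ, γ⟩`. So `A` is the dual of a free module, hence
coinduced from the trivial group, and Shapiro's lemma says that the extension splits.

`nonempty_mulEquiv_freeSemidirect_of_pairing` makes this explicit without cohomology. A
set-theoretic section of `π` embeds `Γ` in the wreath product of `A` and `G` (Kaloujnine–Krasner);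
pairing the `A`-valued coordinates with the `k` free generators gives a homomorphism to `𝔽_p[G]^k ⋊
G` over `G`, and nondegeneracy makes it bijective on kernels.

`nonempty_mulEquiv_freeSemidirect_of_roots` derives the pairing axioms from an abstract notion of
root, which is then instantiated by Artin–Schreier and Kummer theory. When `ξ_p ∉ K`, `Γ` acts on
`L(ξ_p)` through the unique lifts that fix the `p`-th roots of unity; these exist because `Γ` has
`p`-power exponent, which is prime to `p - 1`. -/

/-! ### Extensions of `G` by a kernel dual to a free module -/

section PairingToSemidirect

variable {p k : ℕ} {G : Type*}

theorem freeModuleAction_apply [Group G] (g : G) (v : Multiplicative (Fin k → (ZMod p)[G])) (i : Fin k) :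
    (freeModuleAction p k G g v).toAdd i = MonoidAlgebra.of (ZMod p) G g * v.toAdd i := rfl

/-- The element of `𝔽_p[G]^k` with prescribed coefficients. -/
noncomputable def freeOfCoeff (p k : ℕ) {G : Type*} [Finite G] (w : Fin k → G → ZMod p) :
    Fin k → (ZMod p)[G] :=
  fun i => MonoidAlgebra.ofCoeff (Finsupp.equivFunOnFinite.symm (w i))

theorem freeOfCoeff_coeff [Finite G] (w : Fin k → G → ZMod p) (i : Fin k) (x : G) :
    (freeOfCoeff p k w i).coeff x = w i x := rfl

theorem freeOfCoeff_injective [Finite G] :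
    Function.Injective (freeOfCoeff p k : (Fin k → G → ZMod p) → _) := by
  intro w w' h
  funext i x
  rw [← freeOfCoeff_coeff w, h, freeOfCoeff_coeff]

theorem freeOfCoeff_surjective [Finite G] :
    Function.Surjective (freeOfCoeff p k : (Fin k → G → ZMod p) → _) := by
  intro v
  refine ⟨fun i x => (v i).coeff x, ?_⟩
  funext i
  ext x
  rfl

theorem freeOfCoeff_eq_sum [Group G] [Fintype G] (w : Fin k → G → ZMod p) :
    freeOfCoeff p k w =
      ∑ i, ∑ x, w i x • (Pi.single i (MonoidAlgebra.of (ZMod p) G x) : Fin k → (ZMod p)[G]) := by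
  classical
  funext j
  ext y
  rw [freeOfCoeff_coeff]
  simp only [Finset.sum_apply, Pi.smul_apply, MonoidAlgebra.coeff_sum, MonoidAlgebra.coeff_smul,
    Finsupp.finsetSum_apply, Finsupp.smul_apply]
  rw [Finset.sum_eq_single j, Finset.sum_eq_single y]
  · simp
  · intro x _ hx
    simp [hx]
  · simp
  · intro i _ hi
    simp [Pi.single_eq_of_ne hi.symm]
  · simp

theorem AddMonoidHom.apply_freeOfCoeff [Group G] [Fintype G] (f : (Fin k → (ZMod p)[G]) →+ ZMod p)
    (w : Fin k → G → ZMod p) :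
    f (freeOfCoeff p k w) =
      ∑ i, ∑ x, w i x * f (Pi.single i (MonoidAlgebra.of (ZMod p) G x)) := by
  rw [← AddMonoidHom.coe_toZModLinearMap p f, freeOfCoeff_eq_sum]
  simp only [map_sum, map_smul, smul_eq_mul]

/-- A subgroup of functions on which no nonzero linear form vanishes is everything. -/
theorem AddSubgroup.eq_top_of_forall_sum_eq_zero [Fact p.Prime] [Fintype G]
    (R : AddSubgroup (Fin k → G → ZMod p))
    (h : ∀ c : Fin k → G → ZMod p, (∀ w ∈ R, ∑ i, ∑ x, c i x * w i x = 0) → c = 0) :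
    R = ⊤ := by
  classical
  by_contra hR
  -- A proper subspace lies in the kernel of a nonzero functional `f`; its values on the standard
  -- basis are the coefficients to feed to `h`.
  have hlt : AddSubgroup.toZModSubmodule p R < ⊤ := by
    rw [lt_top_iff_ne_top]
    intro h'
    exact hR (AddSubgroup.toZModSubmodule p |>.injective (by simpa using h'))
  obtain ⟨f, hf, hRf⟩ := Submodule.exists_le_ker_of_lt_top _ hlt
  have hsum : ∀ w, f w = ∑ i, ∑ x, f (Pi.single i (Pi.single x 1)) * w i x := by
    intro w
    have hw : w = ∑ i, ∑ x, w i x • (Pi.single i (Pi.single x 1) : Fin k → G → ZMod p) := by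
      funext j y
      simp only [Finset.sum_apply, Pi.smul_apply]
      rw [Finset.sum_eq_single j, Finset.sum_eq_single y]
      · simp
      · intro x _ hx
        simp [hx]
      · simp
      · intro i _ hi
        simp [Pi.single_eq_of_ne hi.symm]
      · simp
    conv_lhs => rw [hw]
    simp only [map_sum, map_smul, smul_eq_mul, mul_comm]
  have hc := h (fun i x => f (Pi.single i (Pi.single x 1))) fun w hw => by
    rw [← hsum]
    exact hRf hw
  apply hf
  ext w
  simp only [LinearMap.coe_comp, Function.comp_apply]
  rw [hsum]
  simp [funext_iff] at hc
  simp [hc]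

/-- An extension `Γ` of a finite group `G` by a kernel which is dual to `𝔽_p[G]^k` is isomorphic
to `𝔽_p[G]^k ⋊ G`. -/
theorem nonempty_mulEquiv_freeSemidirect_of_pairing [Fact p.Prime] [Group G] [Finite G]
    {Γ : Type*} [Group Γ] (π : Γ →* G) (hπ : Function.Surjective π)
    (φ : π.ker → (Fin k → (ZMod p)[G]) → ZMod p)
    (hmul : ∀ σ τ v, φ (σ * τ) v = φ σ v + φ τ v)
    (hadd : ∀ σ v w, φ σ (v + w) = φ σ v + φ σ w)
    (hleft : ∀ σ, (∀ v, φ σ v = 0) → σ = 1)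
    (hright : ∀ v, (∀ σ, φ σ v = 0) → v = 0)
    (hconj : ∀ (τ : Γ) (σ σ' : π.ker), (σ' : Γ) = τ * σ * τ⁻¹ →
      ∀ v, φ σ' (MonoidAlgebra.of (ZMod p) G (π τ) • v) = φ σ v) :
    Nonempty (Γ ≃* FreeSemidirect p k G) := by
  classical
  -- The section `t` is a mere map of sets; no splitting is assumed.
  have := Fintype.ofFinite G
  obtain ⟨t, ht⟩ := hπ.hasRightInverse
  let e (i : Fin k) (x : G) : Fin k → (ZMod p)[G] := Pi.single i (MonoidAlgebra.of (ZMod p) G x)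
  have he (i : Fin k) (x y : G) : MonoidAlgebra.of (ZMod p) G x • e i y = e i (x * y) := by
    funext j
    by_cases hj : j = i
    · subst hj
      simp [e]
    · simp [e, hj]
  let Φ (σ : π.ker) : (Fin k → (ZMod p)[G]) →+ ZMod p := AddMonoidHom.mk' (φ σ) (hadd σ)
  -- the cocycle of the embedding of `Γ` into the wreath product
  have hc (τ : Γ) (x : G) : (t x)⁻¹ * τ * t ((π τ)⁻¹ * x) ∈ π.ker := by
    rw [MonoidHom.mem_ker]
    simp [ht _]
  let c (τ : Γ) (x : G) : π.ker := ⟨_, hc τ x⟩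
  have hcmul (τ ρ : Γ) (x : G) : c (τ * ρ) x = c τ x * c ρ ((π τ)⁻¹ * x) := by
    ext
    simp [c, mul_assoc]
  -- Only the generators `e i 1` are needed: the coordinate `x` accounts for their translates, as
  -- `hwker` shows. The rule `hwmul` is the crossed-homomorphism identity for left translation.
  let w (τ : Γ) : Fin k → G → ZMod p := fun i x => φ (c τ x) (e i 1)
  have hwmul (τ ρ : Γ) (i : Fin k) (x : G) : w (τ * ρ) i x = w τ i x + w ρ i ((π τ)⁻¹ * x) := by
    simp only [w]
    rw [hcmul, hmul]
  have hwker (σ : π.ker) (i : Fin k) (x : G) : w σ i x = φ σ (e i x) := by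
    -- On the kernel `c σ x` is the conjugate of `σ` by `(t x)⁻¹`, so equivariance moves the
    -- translation by `x` onto the generator.
    have := hconj (t x) (c σ x) σ (by
      have h1 : π σ = 1 := σ.2
      simp [c, h1, mul_assoc]) (e i 1)
    rw [he, ht, mul_one] at this
    exact this.symm
  let f : Γ →* FreeSemidirect p k G := MonoidHom.mk'
    (fun τ => ⟨Multiplicative.ofAdd (freeOfCoeff p k (w τ)), π τ⟩) fun τ ρ => by
      refine SemidirectProduct.ext ?_ (map_mul π τ ρ)
      apply Multiplicative.toAdd.injective
      funext i
      ext x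
      simp only [SemidirectProduct.mul_left, toAdd_mul, toAdd_ofAdd, Pi.add_apply,
        freeModuleAction_apply, MonoidAlgebra.coeff_add, Finsupp.add_apply, freeOfCoeff_coeff,
        MonoidAlgebra.of_apply, MonoidAlgebra.coeff_single_mul_apply, one_mul, hwmul]
  refine ⟨MulEquiv.ofBijective f ⟨?_, ?_⟩⟩
  · rw [injective_iff_map_eq_one]
    intro τ hτ
    have h1 : τ ∈ π.ker := congrArg SemidirectProduct.right hτ
    have h2 : freeOfCoeff p k (w τ) = 0 :=
      congrArg (fun a => Multiplicative.toAdd (SemidirectProduct.left a)) hτ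
    have h3 := hleft ⟨τ, h1⟩ fun v => by
      obtain ⟨u, rfl⟩ := freeOfCoeff_surjective v
      change Φ ⟨τ, h1⟩ _ = 0
      rw [AddMonoidHom.apply_freeOfCoeff]
      refine Finset.sum_eq_zero fun i _ => Finset.sum_eq_zero fun x _ => ?_
      change _ * φ ⟨τ, h1⟩ (e i x) = 0
      rw [← hwker, ← freeOfCoeff_coeff (w τ), h2]
      simp
    exact congrArg Subtype.val h3
  · let ψ : Additive π.ker →+ (Fin k → G → ZMod p) :=
      AddMonoidHom.mk' (fun σ i x => φ σ.toMul (e i x)) fun σ τ => by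
        funext i x
        exact hmul _ _ _
    -- A linear form vanishing on the range has coefficients forming an element of `𝔽_p[G]^k`
    -- orthogonal to the whole kernel, which is zero by `hright`.
    have hψ : ψ.range = ⊤ := by
      refine AddSubgroup.eq_top_of_forall_sum_eq_zero _ fun u hu => ?_
      apply freeOfCoeff_injective
      rw [hright (freeOfCoeff p k u) fun σ => ?_]
      · symm
        exact hright _ fun σ => by
          change Φ σ _ = 0
          rw [AddMonoidHom.apply_freeOfCoeff]
          simp
      · change Φ σ _ = 0
        rw [AddMonoidHom.apply_freeOfCoeff]
        exact hu _ ⟨Additive.ofMul σ, rfl⟩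
    have hker (v : Multiplicative (Fin k → (ZMod p)[G])) : ∃ τ, f τ = SemidirectProduct.inl v := by
      obtain ⟨u, hu⟩ := freeOfCoeff_surjective v.toAdd
      obtain ⟨σ, hσ⟩ : u ∈ ψ.range := hψ ▸ AddSubgroup.mem_top u
      refine ⟨σ.toMul, SemidirectProduct.ext ?_ σ.toMul.2⟩
      apply Multiplicative.toAdd.injective
      change freeOfCoeff p k (w σ.toMul) = v.toAdd
      rw [← hu, ← hσ]
      congr 1
      funext i x
      exact hwker _ _ _
    intro a
    -- Once `f` hits the whole normal factor, lifting the `G`-component suffices.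
    obtain ⟨τ, hτ⟩ := hπ a.right
    obtain ⟨σ, hσ⟩ := hker (a * (f τ)⁻¹).left
    refine ⟨σ * τ, ?_⟩
    rw [map_mul, hσ, ← eq_mul_inv_iff_mul_eq]
    refine SemidirectProduct.ext rfl ?_
    change 1 = a.right * (π τ)⁻¹
    rw [hτ, mul_inv_cancel]

theorem nonempty_mulEquiv_freeSemidirect_of_module_pairing [Fact p.Prime] [Group G] [Finite G]
    {Γ : Type*} [Group Γ] (π : Γ →* G) (hπ : Function.Surjective π)
    {N : Type*} [AddCommGroup N] [Module (ZMod p)[G] N]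
    (e : N ≃ₗ[(ZMod p)[G]] (Fin k → (ZMod p)[G]))
    {C : Type*} [AddCommGroup C] (ι : C →+ ZMod p) (hι : Function.Injective ι)
    (φ : π.ker → N → C)
    (hmul : ∀ σ τ v, φ (σ * τ) v = φ σ v + φ τ v)
    (hadd : ∀ σ v w, φ σ (v + w) = φ σ v + φ σ w)
    (hleft : ∀ σ, (∀ v, φ σ v = 0) → σ = 1)
    (hright : ∀ v, (∀ σ, φ σ v = 0) → v = 0)
    (hconj : ∀ (τ : Γ) (σ σ' : π.ker), (σ' : Γ) = τ * σ * τ⁻¹ →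
      ∀ v, φ σ' (MonoidAlgebra.of (ZMod p) G (π τ) • v) = φ σ v) :
    Nonempty (Γ ≃* FreeSemidirect p k G) := by
  have hz : ∀ c, ι c = 0 ↔ c = 0 := fun c => map_eq_zero_iff ι hι
  refine nonempty_mulEquiv_freeSemidirect_of_pairing π hπ (fun σ v => ι (φ σ (e.symm v)))
    ?_ ?_ ?_ ?_ ?_
  · intro σ τ v
    rw [hmul, map_add]
  · intro σ v w
    rw [map_add, hadd, map_add]
  · intro σ h
    exact hleft σ fun v => by simpa [hz] using h (e v)
  · intro v h
    simpa using hright (e.symm v) fun σ => (hz _).1 (h σ)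
  · intro τ σ σ' h v
    rw [map_smul, hconj τ σ σ' h]

end PairingToSemidirect

/-! ### From roots to a pairing -/

section RootPairing

/-- The pairing `(σ, γ) ↦ σ(x) - x`, where `x` is a root attached to `γ`, identifies an extension
`Γ` of `G` with `𝔽_p[G]^k ⋊ G`. The values of the pairing lie in a group `C` of order `p`
fixed by `Γ`. -/
theorem nonempty_mulEquiv_freeSemidirect_of_roots {p k : ℕ} [Fact p.Prime]
    {G : Type*} [Group G] [Finite G] {Γ : Type*} [Group Γ] (π : Γ →* G)
    (hπ : Function.Surjective π) {N : Type*} [AddCommGroup N] [Module (ZMod p)[G] N]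
    (e : N ≃ₗ[(ZMod p)[G]] (Fin k → (ZMod p)[G]))
    {X : Type*} [AddCommGroup X] (act : Γ → X →+ X)
    (act_mul : ∀ σ τ x, act (σ * τ) x = act σ (act τ x))
    (C : AddSubgroup X) (hC : ∀ c ∈ C, ∀ τ, act τ c = c)
    (ι : C →+ ZMod p) (hι : Function.Injective ι)
    (R : N → X → Prop) (exists_root : ∀ γ, ∃ x, R γ x)
    (root_add : ∀ γ δ x y, R γ x → R δ y → R (γ + δ) (x + y))
    (root_act : ∀ τ γ x, R γ x → R (MonoidAlgebra.of (ZMod p) G (π τ) • γ) (act τ x))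
    (root_sub : ∀ γ x y, R γ x → R γ y → ∀ σ ∈ π.ker, act σ (x - y) = x - y)
    (act_sub_mem : ∀ γ x, R γ x → ∀ σ ∈ π.ker, act σ x - x ∈ C)
    (hleft : ∀ σ ∈ π.ker, (∀ γ x, R γ x → act σ x = x) → σ = 1)
    (hright : ∀ γ x, R γ x → (∀ σ ∈ π.ker, act σ x = x) → γ = 0) :
    Nonempty (Γ ≃* FreeSemidirect p k G) := by
  choose r hr using exists_root
  -- Two roots of the same class differ by an element fixed by the kernel, so the pairing does not
  -- depend on the chosen root `r γ`.
  have hindep : ∀ σ ∈ π.ker, ∀ γ x, R γ x → act σ (r γ) - r γ = act σ x - x := by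
    intro σ hσ γ x hx
    have := root_sub γ x (r γ) hx (hr γ) σ hσ
    rw [map_sub] at this
    rw [sub_eq_sub_iff_add_eq_add] at this ⊢
    rw [add_comm, ← this, add_comm]
  refine nonempty_mulEquiv_freeSemidirect_of_module_pairing π hπ e ι hι
    (fun σ γ => ⟨act σ (r γ) - r γ, act_sub_mem γ _ (hr γ) σ σ.2⟩) ?_ ?_ ?_ ?_ ?_
  · intro σ τ γ
    apply Subtype.ext
    change act (σ * τ : Γ) (r γ) - r γ = (act σ (r γ) - r γ) + (act τ (r γ) - r γ)
    have h := hC _ (act_sub_mem γ _ (hr γ) τ τ.2) σ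
    rw [map_sub, ← act_mul] at h
    rw [← h]
    abel
  · intro σ γ δ
    apply Subtype.ext
    change act σ (r (γ + δ)) - r (γ + δ) = (act σ (r γ) - r γ) + (act σ (r δ) - r δ)
    rw [hindep σ σ.2 _ _ (root_add _ _ _ _ (hr γ) (hr δ)), map_add]
    abel
  · intro σ h
    apply Subtype.ext
    refine hleft σ σ.2 fun γ x hx => ?_
    rw [← sub_eq_zero, ← hindep σ σ.2 γ x hx]
    exact congrArg Subtype.val (h γ)
  · intro γ h
    exact hright γ _ (hr γ) fun σ hσ => sub_eq_zero.1 (congrArg Subtype.val (h ⟨σ, hσ⟩))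
  · intro τ σ σ' h γ
    apply Subtype.ext
    -- Use `τ(r γ)` as the root of the translated class: `σ'τ(r γ) - τ(r γ) = τ(σ(r γ) - r γ)`, and
    -- `τ` fixes values in `C`.
    change act σ' (r _) - r _ = act σ (r γ) - r γ
    rw [hindep σ' σ'.2 _ _ (root_act τ γ _ (hr γ)), ← act_mul, h, inv_mul_cancel_right, act_mul,
      ← map_sub, hC _ (act_sub_mem γ _ (hr γ) σ σ.2)]

end RootPairing

/-! ### Restriction from `Gal(L/F)` to `Gal(K/F)` -/

section GaloisTower

variable {F K L : Type*} [Field F] [Field K] [Field L] [Algebra F K] [Algebra K L] [Algebra F L]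
  [IsScalarTower F K L]

theorem RingHom.eq_of_eqOn_of_adjoin_eq_top {K L L' : Type*} [Field K] [Field L] [Field L']
    [Algebra K L] {S : Set L} (hS : IntermediateField.adjoin K S = ⊤) {f g : L →+* L'}
    (hK : ∀ a : K, f (algebraMap K L a) = g (algebraMap K L a)) (h : ∀ x ∈ S, f x = g x) :
    f = g := by
  ext x
  have hx : x ∈ IntermediateField.adjoin K S := hS ▸ IntermediateField.mem_top
  induction hx using IntermediateField.adjoin_induction with
  | mem x hx => exact h x hx
  | algebraMap a => exact hK a
  | add x y _ _ hx hy => rw [map_add, map_add, hx, hy]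
  | inv x _ hx => rw [map_inv₀, map_inv₀, hx]
  | mul x y _ _ hx hy => rw [map_mul, map_mul, hx, hy]

variable [Normal F K]

theorem AlgEquiv.apply_algebraMap_eq_restrictNormalHom (τ : Gal(L/F)) (a : K) :
    τ (algebraMap K L a) = algebraMap K L (AlgEquiv.restrictNormalHom K τ a) :=
  (AlgEquiv.restrictNormal_commutes τ K a).symm

theorem AlgEquiv.apply_algebraMap_of_mem_ker {σ : Gal(L/F)}
    (hσ : σ ∈ (AlgEquiv.restrictNormalHom K : Gal(L/F) →* Gal(K/F)).ker) (a : K) :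
    σ (algebraMap K L a) = algebraMap K L a := by
  rw [AlgEquiv.apply_algebraMap_eq_restrictNormalHom, MonoidHom.mem_ker.1 hσ, AlgEquiv.one_apply]

theorem AlgEquiv.mem_ker_restrictNormalHom {σ : Gal(L/F)}
    (h : ∀ a : K, σ (algebraMap K L a) = algebraMap K L a) :
    σ ∈ (AlgEquiv.restrictNormalHom K : Gal(L/F) →* Gal(K/F)).ker := by
  rw [MonoidHom.mem_ker]
  ext a
  apply (algebraMap K L).injective
  rw [← AlgEquiv.apply_algebraMap_eq_restrictNormalHom, h, AlgEquiv.one_apply]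

theorem IsElementaryAbelianExt.pow_eq_one_of_mem_ker {p : ℕ} (hL : IsElementaryAbelianExt p K L)
    {σ : Gal(L/F)} (hσ : σ ∈ (AlgEquiv.restrictNormalHom K : Gal(L/F) →* Gal(K/F)).ker) :
    σ ^ p = 1 := by
  let σ' : Gal(L/K) := AlgEquiv.ofRingEquiv (f := (σ : L ≃+* L))
    (AlgEquiv.apply_algebraMap_of_mem_ker hσ)
  have hσ' : ∀ (m : ℕ) (x : L), (σ' ^ m) x = (σ ^ m) x := by
    intro m
    induction m with
    | zero => intro x; rfl
    | succ m ih =>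
      intro x
      rw [pow_succ, pow_succ, AlgEquiv.mul_apply, AlgEquiv.mul_apply, ih]
      rfl
  ext x
  rw [← hσ', hL.pow_eq_one]
  rfl

/-- The quotient `Gal(K/F)` is killed by `p ^ n` and the kernel by `p`. A `p`-power exponent is what
allows lifting to `L(ξ_p)` with the roots of unity fixed. -/
theorem IsElementaryAbelianExt.pow_eq_one_of_mulEquiv {p n : ℕ}
    (hL : IsElementaryAbelianExt p K L)
    (hG : Nonempty (Gal(K/F) ≃* Multiplicative (ZMod (p ^ n)))) (τ : Gal(L/F)) :
    τ ^ p ^ (n + 1) = 1 := by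
  rw [pow_succ p n, pow_mul]
  apply hL.pow_eq_one_of_mem_ker
  rw [MonoidHom.mem_ker, map_pow]
  obtain ⟨e⟩ := hG
  apply e.injective
  rw [map_pow, map_one]
  apply Multiplicative.toAdd.injective
  rw [toAdd_pow, toAdd_one, nsmul_eq_mul, CharP.cast_eq_zero, zero_mul]

end GaloisTower

/-! ### Artin–Schreier theory: roots of `X ^ p - X - a` -/

section ArtinSchreierPairing

theorem mem_range_castHom_iff {p : ℕ} [Fact p.Prime] {L : Type*} [Field L] [CharP L p] {x : L} :
    x ∈ (ZMod.castHom dvd_rfl L : ZMod p →+* L).toAddMonoidHom.range ↔ x ^ p = x := by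
  rw [← Subfield.mem_bot_iff_pow_eq_self L p, ← ZMod.fieldRange_castHom_eq_bot p]
  rfl

theorem map_castHom_zmod {p : ℕ} {L : Type*} [Field L] [CharP L p] (f : L →+* L) (z : ZMod p) :
    f (ZMod.castHom dvd_rfl L z) = ZMod.castHom dvd_rfl L z :=
  RingHom.congr_fun (Subsingleton.elim (f.comp (ZMod.castHom dvd_rfl L)) _) z

theorem nonempty_mulEquiv_freeSemidirect_of_isASExtOf {p k : ℕ} [Fact p.Prime]
    {F K L : Type*} [Field F] [Field K] [Field L] [Algebra F K] [Algebra K L] [Algebra F L]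
    [IsScalarTower F K L] [FiniteDimensional F K] [IsGalois F K] [IsGalois F L] [CharP K p]
    {N : Type*} [AddCommGroup N] [Module (ZMod p)[Gal(K/F)] N]
    (e : N ≃ₗ[(ZMod p)[Gal(K/F)]] (Fin k → (ZMod p)[Gal(K/F)]))
    (j : N →+ ASClasses p K) (hj : Function.Injective j)
    (hsmul : ∀ g γ, j (MonoidAlgebra.of (ZMod p) Gal(K/F) g • γ) = asRep p F K g (j γ))
    (hL : IsASExtOf p L (Set.range j)) :
    Nonempty (Gal(L/F) ≃* FreeSemidirect p k Gal(K/F)) := by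
  have : CharP L p := charP_of_injective_algebraMap (algebraMap K L).injective p
  have : IsGalois K L := IsGalois.tower_top_of_isGalois F K L
  have hinj : Function.Injective (ZMod.castHom dvd_rfl L : ZMod p →+* L).toAddMonoidHom :=
    ZMod.castHom_injective L
  refine nonempty_mulEquiv_freeSemidirect_of_roots (AlgEquiv.restrictNormalHom K)
    (AlgEquiv.restrictNormalHom_surjective L) e (fun τ : Gal(L/F) => (τ : L →+ L))
    (fun _ _ _ => rfl) (ZMod.castHom dvd_rfl L : ZMod p →+* L).toAddMonoidHom.range ?_
    (AddMonoidHom.ofInjective hinj).symm (AddMonoidHom.ofInjective hinj).symm.injective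
    (fun γ x => ∃ a : K, (QuotientAddGroup.mk a : ASClasses p K) = j γ ∧
      x ^ p - x = algebraMap K L a) ?_ ?_ ?_ ?_ ?_ ?_ ?_
  · rintro _ ⟨c, rfl⟩ τ
    exact map_castHom_zmod (τ : L →+* L) c
  · intro γ
    obtain ⟨a, ha⟩ := QuotientAddGroup.mk_surjective (j γ)
    obtain ⟨x, hx⟩ := hL.1 a ⟨γ, ha.symm⟩
    exact ⟨x, a, ha, hx⟩
  · rintro γ δ x y ⟨a, ha, hx⟩ ⟨b, hb, hy⟩
    refine ⟨a + b, by rw [map_add, ← ha, ← hb]; rfl, ?_⟩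
    rw [map_add, ← hx, ← hy, add_pow_char]
    ring
  · rintro τ γ x ⟨a, ha, hx⟩
    refine ⟨AlgEquiv.restrictNormalHom K τ a, by rw [hsmul, ← ha]; rfl, ?_⟩
    rw [← AlgEquiv.apply_algebraMap_eq_restrictNormalHom, ← hx, map_sub, map_pow]
    rfl
  · rintro γ x y ⟨a, ha, hx⟩ ⟨b, hb, hy⟩ σ hσ
    obtain ⟨c, hc⟩ := QuotientAddGroup.eq.1 (hb.trans ha.symm)
    -- The classes agree, so `a - b = c ^ p - c`; then `x - y - c` is a zero of `X ^ p - X`, hence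
    -- in the prime field.
    have hmem : x - y - algebraMap K L c ∈
        (ZMod.castHom dvd_rfl L : ZMod p →+* L).toAddMonoidHom.range := by
      rw [mem_range_castHom_iff, sub_pow_char, sub_pow_char]
      have : algebraMap K L c ^ p - algebraMap K L c = - algebraMap K L b + algebraMap K L a := by
        rw [← map_neg, ← map_add, ← hc, ← map_pow, ← map_sub]
        rfl
      linear_combination hx - hy - this
    obtain ⟨z, hz⟩ := hmem
    have hxy : x - y = ZMod.castHom dvd_rfl L z + algebraMap K L c :=
      sub_eq_iff_eq_add.1 hz.symm
    rw [hxy, map_add]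
    exact congrArg₂ _ (map_castHom_zmod (σ : L →+* L) z) (AlgEquiv.apply_algebraMap_of_mem_ker hσ c)
  · rintro γ x ⟨a, ha, hx⟩ σ hσ
    rw [mem_range_castHom_iff]
    have := AlgEquiv.apply_algebraMap_of_mem_ker hσ a
    rw [← hx, map_sub, map_pow] at this
    change (σ x - x) ^ p = σ x - x
    rw [sub_pow_char]
    linear_combination this
  · intro σ hσ h
    have : (σ : L →+* L) = RingHom.id L := RingHom.eq_of_eqOn_of_adjoin_eq_top hL.2
      (AlgEquiv.apply_algebraMap_of_mem_ker hσ) fun x ⟨a, ⟨γ, hγ⟩, hx⟩ => h γ x ⟨a, hγ.symm, hx⟩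
    ext x
    exact RingHom.congr_fun this x
  · rintro γ x ⟨a, ha, hx⟩ h
    -- The Galois correspondence for possibly infinite extensions is used, since `L / K` is not
    -- assumed finite.
    obtain ⟨c, rfl⟩ := (InfiniteGalois.mem_range_algebraMap_iff_fixed (k := K) x).2 fun σ =>
      h (σ.restrictScalars F) (AlgEquiv.mem_ker_restrictNormalHom σ.commutes)
    apply hj
    rw [map_zero, ← ha]
    refine (QuotientAddGroup.eq_zero_iff a).2 ⟨c, ?_⟩
    apply (algebraMap K L).injective
    rw [← hx, ← map_pow, ← map_sub]
    rfl

end ArtinSchreierPairing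

/-! ### Lifting automorphisms to `L(ξ_p)` -/

section CyclotomicLift

variable {p : ℕ} [Fact p.Prime] {F L M : Type*} [Field F] [Field L] [Field M] [Algebra F L]
  [Algebra F M] [Algebra L M] [IsScalarTower F L M]

/-- `M` is the compositum of `L` and `F(ζ)`, both Galois over `F`. -/
theorem IsGalois.of_isCyclotomicExtension [IsGalois F L] [IsCyclotomicExtension {p} L M] :
    IsGalois F M := by
  have hp : p.Prime := Fact.out
  have : NeZero p := ⟨hp.ne_zero⟩
  obtain ⟨ζ, hζ⟩ := IsCyclotomicExtension.exists_isPrimitiveRoot (S := {p}) L M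
    (Set.mem_singleton p) hp.ne_zero
  have : Algebra.IsIntegral L M := IsCyclotomicExtension.integral {p} L M
  have : Algebra.IsIntegral F M := Algebra.IsIntegral.trans L
  have := hζ.intermediateField_adjoin_isCyclotomicExtension F
  have : IsGalois F (IntermediateField.adjoin F {ζ}) := IsCyclotomicExtension.isGalois {p} F _
  have : IsGalois F (IsScalarTower.toAlgHom F L M).fieldRange :=
    IsGalois.of_algEquiv (AlgEquiv.ofInjectiveField (IsScalarTower.toAlgHom F L M))
  have hsup : (IsScalarTower.toAlgHom F L M).fieldRange ⊔ IntermediateField.adjoin F {ζ} = ⊤ := by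
    rw [eq_top_iff]
    intro x _
    have hx := IsCyclotomicExtension.adjoin_roots (S := {p}) (A := L) (B := M) x
    induction hx using Algebra.adjoin_induction with
    | mem y hy =>
      obtain ⟨m, hm, -, hy⟩ := hy
      rw [Set.mem_singleton_iff] at hm
      subst hm
      obtain ⟨i, -, rfl⟩ := hζ.eq_pow_of_pow_eq_one hy
      exact pow_mem ((le_sup_right : _ ≤ (IsScalarTower.toAlgHom F L M).fieldRange ⊔ _)
        (IntermediateField.mem_adjoin_simple_self F ζ)) i
    | algebraMap a =>
      exact (le_sup_left : _ ≤ _ ⊔ IntermediateField.adjoin F {ζ}) ⟨a, rfl⟩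
    | add a b _ _ ha hb => exact add_mem (ha trivial) (hb trivial)
    | mul a b _ _ ha hb => exact mul_mem (ha trivial) (hb trivial)
  have hgal : IsGalois F ((IsScalarTower.toAlgHom F L M).fieldRange ⊔
      IntermediateField.adjoin F {ζ} : IntermediateField F M) :=
    { to_isSeparable := IntermediateField.isSeparable_sup F M _ _
      to_normal := IntermediateField.normal_sup F M _ _ }
  rw [hsup] at hgal
  exact IsGalois.of_algEquiv IntermediateField.topEquiv

/-- Take any lift `h` of `g` and an `m` with `m ≡ 1` mod `p ^ n` and `m ≡ 0` mod `p - 1`. Then `h ^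
m` still extends `g`, and by Fermat it acts trivially on the `p`-th roots of unity. Neither
finiteness of `L / F` nor a cyclic group is required, only the order condition on `g`. -/
theorem exists_extendsFixingRoots_of_pow_eq_one [IsGalois F L] [IsCyclotomicExtension {p} L M]
    {n : ℕ} {g : Gal(L/F)} (hg : g ^ p ^ n = 1) : ∃ h : Gal(M/F), ExtendsFixingRoots p M g h := by
  have hp : p.Prime := Fact.out
  have : NeZero p := ⟨hp.ne_zero⟩
  have : IsGalois F M := IsGalois.of_isCyclotomicExtension (p := p) (L := L)
  obtain ⟨ζ₀, hζ₀⟩ := IsCyclotomicExtension.exists_isPrimitiveRoot (S := {p}) L M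
    (Set.mem_singleton p) hp.ne_zero
  have hco : Nat.Coprime (p ^ n) (p - 1) := by
    apply Nat.Coprime.pow_left
    rw [Nat.Prime.coprime_iff_not_dvd hp]
    intro hd
    have := hp.two_le
    have := Nat.le_of_dvd (by omega) hd
    omega
  obtain ⟨m, hm1, hm2⟩ := Nat.chineseRemainder hco 1 0
  have hgm : g ^ m = g := by
    have := pow_eq_pow_iff_modEq.2 (hm1.of_dvd (orderOf_dvd_of_pow_eq_one hg))
    rwa [pow_one] at this
  set h := AlgEquiv.liftNormal g M with hh
  have hpow : ∀ (j : ℕ) (x : L), (h ^ j) (algebraMap L M x) = algebraMap L M ((g ^ j) x) := by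
    intro j
    induction j with
    | zero => intro x; rfl
    | succ j ih =>
      intro x
      rw [pow_succ, pow_succ, AlgEquiv.mul_apply, AlgEquiv.mul_apply, hh,
        AlgEquiv.liftNormal_commutes, ← hh, ih]
  refine ⟨h ^ m, fun x => by rw [hpow, hgm], fun ζ hζ => ?_⟩
  obtain ⟨i, -, hi⟩ := hζ₀.eq_pow_of_pow_eq_one (ξ := h ζ₀) (by
    rw [← map_pow, hζ₀.pow_eq_one, map_one])
  have hact : ∀ (j : ℕ) (ζ : M), ζ ^ p = 1 → (h ^ j) ζ = ζ ^ (i ^ j) := by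
    intro j
    induction j with
    | zero => intro ζ _; rw [pow_zero, pow_zero, pow_one]; rfl
    | succ j ih =>
      intro ζ hζ
      obtain ⟨l, -, rfl⟩ := hζ₀.eq_pow_of_pow_eq_one hζ
      rw [pow_succ, AlgEquiv.mul_apply, map_pow, ← hi, map_pow, map_pow, ih ζ₀ hζ₀.pow_eq_one]
      simp only [← pow_mul]
      ring_nf
  rw [hact m ζ hζ]
  have hpi : ¬ p ∣ i := by
    rintro ⟨c, rfl⟩
    rw [pow_mul, hζ₀.pow_eq_one, one_pow] at hi
    have h1 : ζ₀ = 1 := h.injective (by rw [← hi, map_one])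
    exact hζ₀.ne_one hp.one_lt h1
  obtain ⟨c, rfl⟩ := (Nat.modEq_zero_iff_dvd).1 hm2
  have hfer : i ^ ((p - 1) * c) ≡ 1 [MOD p] := by
    have := Nat.ModEq.pow_totient ((Nat.Prime.coprime_iff_not_dvd hp).2 hpi).symm
    rw [Nat.totient_prime hp] at this
    simpa [pow_mul] using this.pow c
  rw [pow_eq_pow_mod _ hζ, hfer, ← pow_eq_pow_mod _ hζ, pow_one]

end CyclotomicLift

/-! ### Kummer theory over `E = K(ξ_p)` -/

section KummerPairing

theorem PowerClasses.mk_mul (p : ℕ) {E : Type*} [Field E] (u v : Eˣ) :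
    PowerClasses.mk p (u * v) = PowerClasses.mk p u + PowerClasses.mk p v := rfl

theorem PowerClasses.mk_eq_mk_iff {p : ℕ} {E : Type*} [Field E] {u v : Eˣ} :
    PowerClasses.mk p u = PowerClasses.mk p v ↔ ∃ c : Eˣ, c ^ p = u⁻¹ * v :=
  QuotientGroup.eq (s := (powMonoidHom p : Eˣ →* Eˣ).range)

theorem PowerClasses.mk_eq_zero_iff {p : ℕ} {E : Type*} [Field E] {u : Eˣ} :
    PowerClasses.mk p u = 0 ↔ ∃ c : Eˣ, c ^ p = u :=
  QuotientGroup.eq_one_iff (N := (powMonoidHom p : Eˣ →* Eˣ).range) u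

theorem IsCyclotomicExtension.ringHom_ext {p : ℕ} {K E R : Type*} [Field K] [Field E] [Semiring R]
    [Algebra K E] [IsCyclotomicExtension {p} K E] {f g : E →+* R}
    (hK : ∀ a : K, f (algebraMap K E a) = g (algebraMap K E a))
    (h : ∀ ζ : E, ζ ^ p = 1 → f ζ = g ζ) : f = g := by
  ext x
  have hx := IsCyclotomicExtension.adjoin_roots (S := {p}) (A := K) (B := E) x
  induction hx using Algebra.adjoin_induction with
  | mem y hy =>
    obtain ⟨m, hm, -, hy⟩ := hy
    rw [Set.mem_singleton_iff] at hm
    subst hm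
    exact h y hy
  | algebraMap r => exact hK r
  | add a b _ _ ha hb => rw [map_add, map_add, ha, hb]
  | mul a b _ _ ha hb => rw [map_mul, map_mul, ha, hb]

/-- `Gal(L/F)` acts on `Mˣ`, written additively, through the lifts `l`; the values of the pairing
are the `p`-th roots of unity, which these lifts fix. Keeping `E` and `M` general covers `ξ_p ∈ K`
too, with `E = K` and `M = L`. -/
theorem nonempty_mulEquiv_freeSemidirect_of_isKummerExtOf {p k m : ℕ} [Fact p.Prime]
    {F K L E M : Type*} [Field F] [Field K] [Field L] [Field E] [Field M]
    [Algebra F K] [Algebra K L] [Algebra F L] [IsScalarTower F K L]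
    [FiniteDimensional F K] [IsGalois F K] [IsGalois F L]
    [Algebra F E] [Algebra K E] [IsScalarTower F K E] [IsCyclotomicExtension {p} K E]
    [Algebra F M] [Algebra K M] [Algebra L M] [Algebra E M] [IsScalarTower F L M]
    [IsScalarTower F E M] [IsScalarTower K L M] [IsScalarTower K E M]
    [IsCyclotomicExtension {p} L M]
    (hpow : ∀ τ : Gal(L/F), τ ^ p ^ m = 1)
    (c : Gal(K/F) → Gal(E/F)) (hc : ∀ g, ExtendsFixingRoots p E g (c g))
    {N : Type*} [AddCommGroup N] [Module (ZMod p)[Gal(K/F)] N]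
    (e : N ≃ₗ[(ZMod p)[Gal(K/F)]] (Fin k → (ZMod p)[Gal(K/F)]))
    (j : N →+ PowerClasses p E) (hj : Function.Injective j)
    (hsmul : ∀ g γ, j (MonoidAlgebra.of (ZMod p) Gal(K/F) g • γ) = powerRep p F E (c g) (j γ))
    (hM : IsKummerExtOf p M (Set.range j)) :
    Nonempty (Gal(L/F) ≃* FreeSemidirect p k Gal(K/F)) := by
  have hp : p.Prime := Fact.out
  have : NeZero p := ⟨hp.ne_zero⟩
  have : IsGalois F M := IsGalois.of_isCyclotomicExtension (p := p) (L := L)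
  have : IsGalois E M := IsGalois.tower_top_of_isGalois F E M
  obtain ⟨ξ, hξ⟩ := IsCyclotomicExtension.exists_isPrimitiveRoot (S := {p}) K E
    (Set.mem_singleton p) hp.ne_zero
  have hξM : IsPrimitiveRoot (algebraMap E M ξ) p := hξ.map_of_injective (algebraMap E M).injective
  have hroot : ∀ ζ : M, ζ ^ p = 1 → ∃ η : E, algebraMap E M η = ζ := fun ζ hζ => by
    obtain ⟨i, -, rfl⟩ := hξM.eq_pow_of_pow_eq_one hζ
    exact ⟨ξ ^ i, map_pow _ _ _⟩
  obtain ⟨z, hz⟩ := hξM.isUnit hp.ne_zero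
  have hzprim : IsPrimitiveRoot z p := by
    rw [← IsPrimitiveRoot.coe_units_iff, hz]
    exact hξM
  have hzmem : ∀ y : Mˣ, y ∈ Subgroup.zpowers z ↔ (y : M) ^ p = 1 := fun y => by
    rw [hzprim.zpowers_eq, mem_rootsOfUnity']
  choose l hl using fun τ : Gal(L/F) =>
    exists_extendsFixingRoots_of_pow_eq_one (M := M) (hpow τ)
  have lmul : ∀ σ τ, l (σ * τ) = l σ * l τ := fun σ τ => (hl (σ * τ)).unique p
    ⟨fun x => by rw [AlgEquiv.mul_apply, (hl τ).1, (hl σ).1, AlgEquiv.mul_apply],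
      fun ζ hζ => by rw [AlgEquiv.mul_apply, (hl τ).2 ζ hζ, (hl σ).2 ζ hζ]⟩
  -- Both sides agree on `K` and fix the `p`-th roots of unity, and these generate `E`. This matches
  -- the action on roots with the module structure of `N`.
  have hlE : ∀ (τ : Gal(L/F)) (a : E),
      l τ (algebraMap E M a) = algebraMap E M (c (AlgEquiv.restrictNormalHom K τ) a) := by
    intro τ
    have : (l τ : M →+* M).comp (algebraMap E M) =
        (algebraMap E M).comp (c (AlgEquiv.restrictNormalHom K τ) : E →+* E) := by
      refine IsCyclotomicExtension.ringHom_ext (p := p) (K := K) (fun a => ?_) fun ζ hζ => ?_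
      · change l τ (algebraMap E M (algebraMap K E a)) = algebraMap E M (c _ (algebraMap K E a))
        rw [(hc _).1, ← IsScalarTower.algebraMap_apply, ← IsScalarTower.algebraMap_apply,
          IsScalarTower.algebraMap_apply K L M, (hl τ).1, IsScalarTower.algebraMap_apply K L M,
          AlgEquiv.apply_algebraMap_eq_restrictNormalHom]
      · change l τ (algebraMap E M ζ) = algebraMap E M (c _ ζ)
        rw [(hc _).2 ζ hζ, (hl τ).2 _ (by rw [← map_pow, hζ, map_one])]
    exact RingHom.congr_fun this
  have hc1 : c 1 = 1 := (hc 1).unique p ⟨fun _ => rfl, fun _ _ => rfl⟩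
  have hlE' : ∀ σ ∈ (AlgEquiv.restrictNormalHom K : Gal(L/F) →* Gal(K/F)).ker, ∀ a : E,
      l σ (algebraMap E M a) = algebraMap E M a := fun σ hσ a => by
    rw [hlE, MonoidHom.mem_ker.1 hσ, hc1, AlgEquiv.one_apply]
  let act (τ : Gal(L/F)) : Additive Mˣ →+ Additive Mˣ :=
    MonoidHom.toAdditive (Units.map (l τ : M →* M))
  have act_val : ∀ τ (x : Additive Mˣ), ((act τ x).toMul : M) = l τ (x.toMul : M) :=
    fun _ _ => rfl
  have ext : ∀ x y : Additive Mˣ, (x.toMul : M) = y.toMul → x = y := fun x y h => Units.ext h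
  -- The discrete logarithm to the base `z`.
  let ι : Subgroup.toAddSubgroup (Subgroup.zpowers z) →+ ZMod p := AddMonoidHom.mk'
    (fun y => hzprim.zmodEquivZPowers.symm (Additive.ofMul ⟨y.1.toMul, y.2⟩))
    fun _ _ => map_add hzprim.zmodEquivZPowers.symm _ _
  have hι : Function.Injective ι := fun y y' h => Subtype.ext
    (congrArg (fun x : Additive (Subgroup.zpowers z) => Additive.ofMul (x.toMul : Mˣ))
      (hzprim.zmodEquivZPowers.symm.injective h))
  refine nonempty_mulEquiv_freeSemidirect_of_roots (AlgEquiv.restrictNormalHom K)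
    (AlgEquiv.restrictNormalHom_surjective L) e act
    (fun σ τ x => ext _ _ (by rw [act_val, lmul]; rfl)) (Subgroup.toAddSubgroup (.zpowers z)) ?_ ι hι
    (fun γ x => ∃ u : Eˣ, PowerClasses.mk p u = j γ ∧ (x.toMul : M) ^ p = algebraMap E M u)
    ?_ ?_ ?_ ?_ ?_ ?_ ?_
  · intro y hy τ
    exact ext _ _ ((hl τ).2 _ ((hzmem y.toMul).1 hy))
  · intro γ
    obtain ⟨u, hu⟩ := PowerClasses.mk_surjective p (j γ)
    obtain ⟨x, hx⟩ := hM.1 u ⟨γ, hu.symm⟩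
    have hx0 : x ≠ 0 := by
      rintro rfl
      rw [zero_pow hp.ne_zero] at hx
      exact u.ne_zero ((map_eq_zero (algebraMap E M)).1 hx.symm)
    exact ⟨Additive.ofMul (Units.mk0 x hx0), u, hu, hx⟩
  · rintro γ δ x y ⟨u, hu, hx⟩ ⟨v, hv, hy⟩
    refine ⟨u * v, by rw [map_add, PowerClasses.mk_mul, hu, hv], ?_⟩
    rw [toMul_add, Units.val_mul, mul_pow, hx, hy, Units.val_mul, map_mul]
  · rintro τ γ x ⟨u, hu, hx⟩
    refine ⟨Units.map (c (AlgEquiv.restrictNormalHom K τ) : E →* E) u,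
      by rw [hsmul, ← hu, powerRep_mk], ?_⟩
    rw [act_val, ← map_pow, hx, hlE]
    rfl
  · rintro γ x y ⟨u, hu, hx⟩ ⟨v, hv, hy⟩ σ hσ
    obtain ⟨b, hb⟩ := PowerClasses.mk_eq_mk_iff.1 (hv.trans hu.symm)
    have hb' : algebraMap E M (b : E) ^ p = (algebraMap E M v)⁻¹ * algebraMap E M u := by
      rw [← map_pow, ← Units.val_pow_eq_pow_val, hb, Units.val_mul, map_mul,
        Units.val_inv_eq_inv_val, map_inv₀]
    have hb0 : algebraMap E M (b : E) ≠ 0 := (map_ne_zero _).2 b.ne_zero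
    -- As `u / v = b ^ p`, the quotient `x / (y b)` is a `p`-th root of unity, so `x / y` lies in
    -- `E`.
    obtain ⟨η, hη⟩ := hroot ((x.toMul : M) / y.toMul / algebraMap E M b) (by
      rw [div_pow, div_pow, hx, hy, hb', inv_mul_eq_div, div_self]
      rw [← map_div₀]
      exact (map_ne_zero _).2 (div_ne_zero u.ne_zero v.ne_zero))
    apply ext
    have hxy : ((x - y).toMul : M) = algebraMap E M (η * b) := by
      rw [map_mul, hη, div_mul_cancel₀ _ hb0, toMul_sub, Units.val_div_eq_div_val]
    rw [act_val, hxy, hlE' σ hσ]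
  · rintro γ x ⟨u, hu, hx⟩ σ hσ
    refine (hzmem (act σ x - x).toMul).2 ?_
    rw [toMul_sub, Units.val_div_eq_div_val, act_val, div_pow, ← map_pow, hx, hlE' σ hσ, div_self]
    exact (map_ne_zero _).2 u.ne_zero
  · intro σ hσ h
    have h1 : (l σ : M →+* M) = RingHom.id M := by
      refine RingHom.eq_of_eqOn_of_adjoin_eq_top hM.2 (hlE' σ hσ) ?_
      rintro x ⟨u, ⟨γ, hγ⟩, hx⟩
      have hx0 : x ≠ 0 := by
        rintro rfl
        rw [zero_pow hp.ne_zero] at hx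
        exact u.ne_zero ((map_eq_zero (algebraMap E M)).1 hx.symm)
      exact congrArg (fun y : Additive Mˣ => (y.toMul : M))
        (h γ (Additive.ofMul (Units.mk0 x hx0)) ⟨u, hγ.symm, hx⟩)
    ext x
    apply (algebraMap L M).injective
    rw [← (hl σ).1]
    exact RingHom.congr_fun h1 _
  · rintro γ x ⟨u, hu, hx⟩ h
    obtain ⟨b, hb⟩ : (x.toMul : M) ∈ Set.range (algebraMap E M) := by
      refine (InfiniteGalois.mem_range_algebraMap_iff_fixed _).2 fun f => ?_
      let f' : Gal(M/F) := f.restrictScalars F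
      let σ : Gal(L/F) := AlgEquiv.restrictNormalHom L f'
      have hσ : ∀ y : L, f' (algebraMap L M y) = algebraMap L M (σ y) :=
        AlgEquiv.apply_algebraMap_eq_restrictNormalHom f'
      -- An automorphism of `M / E` fixes the roots of unity, so it is the distinguished lift of its
      -- restriction to `L`. Thus being fixed by the kernel means being fixed by all of `Gal(M/E)`.
      have hf : l σ = f' := (hl σ).unique p ⟨hσ, fun ζ hζ => by
        obtain ⟨η, rfl⟩ := hroot ζ hζ
        exact f.commutes η⟩
      have hker : σ ∈ (AlgEquiv.restrictNormalHom K : Gal(L/F) →* Gal(K/F)).ker := by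
        refine AlgEquiv.mem_ker_restrictNormalHom fun a => ?_
        apply (algebraMap L M).injective
        rw [← hσ, ← IsScalarTower.algebraMap_apply, IsScalarTower.algebraMap_apply K E M]
        exact f.commutes _
      have := congrArg (fun y : Additive Mˣ => (y.toMul : M)) (h σ hker)
      rw [act_val, hf] at this
      exact this
    have hb0 : b ≠ 0 := by
      rintro rfl
      rw [map_zero] at hb
      exact x.toMul.ne_zero hb.symm
    apply hj
    rw [map_zero, ← hu, PowerClasses.mk_eq_zero_iff]
    refine ⟨Units.mk0 b hb0, Units.ext ((algebraMap E M).injective ?_)⟩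
    rw [← hx, ← hb, ← map_pow]
    rfl

end KummerPairing

/-! ### The three settings -/

theorem IsCyclotomicExtension.self_of_isPrimitiveRoot {p : ℕ} {K : Type*} [Field K] {ξ : K}
    (hξ : IsPrimitiveRoot ξ p) : IsCyclotomicExtension {p} K K := by
  rw [isCyclotomicExtension_iff]
  refine ⟨fun hs _ => ?_, fun x => Subalgebra.algebraMap_mem _ x⟩
  rw [Set.mem_singleton_iff.1 hs]
  exact ⟨ξ, hξ⟩

/-- The inclusion of a submodule of the module attached to a representation into the underlying
space of the representation. -/
noncomputable def Representation.submoduleInclusion {R G V : Type*} [CommRing R] [Group G] [AddCommGroup V]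
    [Module R V] (ρ : Representation R G V) (N : Submodule R[G] ρ.asModule) : N →+ V :=
  (ρ.asModuleEquiv : ρ.asModule →+ V).comp (N.subtype : N →+ ρ.asModule)

section submoduleInclusion

variable {R G V : Type*} [CommRing R] [Group G] [AddCommGroup V]
  [Module R V] (ρ : Representation R G V) (N : Submodule R[G] ρ.asModule)

theorem Representation.submoduleInclusion_injective :
    Function.Injective (ρ.submoduleInclusion N) :=
  ρ.asModuleEquiv.injective.comp Subtype.val_injective

theorem Representation.range_submoduleInclusion :
    Set.range (ρ.submoduleInclusion N) = ρ.asModuleEquiv '' (N : Set ρ.asModule) := by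
  ext v
  constructor
  · rintro ⟨x, rfl⟩
    exact ⟨x, x.2, rfl⟩
  · rintro ⟨x, hx, rfl⟩
    exact ⟨⟨x, hx⟩, rfl⟩

theorem Representation.submoduleInclusion_of_smul (g : G) (x : N) :
    ρ.submoduleInclusion N (MonoidAlgebra.of R G g • x) = ρ g (ρ.submoduleInclusion N x) := by
  refine (ρ.asModuleEquiv_map_smul _ (x : ρ.asModule)).trans ?_
  rw [Representation.asAlgebraHom_of]
  rfl

end submoduleInclusion

theorem lemma4p1 {p n : ℕ} [Fact p.Prime] (hn : 0 < n) (hn2 : p = 2 → 2 ≤ n) (k : ℕ)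
    {F K L : Type*} [Field F] [Field K] [Field L] [Algebra F K] [Algebra K L] [Algebra F L]
    [IsScalarTower F K L]
    -- `K / F` is a `G`-extension, with `G = ℤ/p^n`
    [FiniteDimensional F K] [IsGalois F K]
    (hG : Nonempty (Gal(K/F) ≃* Multiplicative (ZMod (p ^ n))))
    -- `L / K` is elementary `p`-abelian and Galois over `F`
    (hL : IsElementaryAbelianExt p K L) [IsGalois F L] :
    -- `ξ_p ∈ K`: `J = K^× / K^{×p}` and `L = K(γ^{1/p} : γ ∈ N)`
    ((∃ ξ : K, IsPrimitiveRoot ξ p) →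
      ∀ N : Submodule (ZMod p)[Gal(K/F)] (powerRep p F K).asModule,
        IsKummerExtOf p L ((powerRep p F K).asModuleEquiv '' (N : Set (powerRep p F K).asModule)) →
        Nonempty (N ≃ₗ[(ZMod p)[Gal(K/F)]] (Fin k → (ZMod p)[Gal(K/F)])) →
        Nonempty (Gal(L/F) ≃* FreeSemidirect p k Gal(K/F))) ∧
    -- `char K ≠ p`: `J ⊆ E^× / E^{×p}` with `E = K(ξ_p)`, and `L(ξ_p) = E(γ^{1/p} : γ ∈ N)`
    ((p : K) ≠ 0 →
      ∀ (E M : Type*) [Field E] [Field M] [Algebra F E] [Algebra K E] [IsScalarTower F K E]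
        [IsCyclotomicExtension {p} K E] [Algebra K M] [Algebra L M] [Algebra E M]
        [IsScalarTower K L M] [IsScalarTower K E M] [IsCyclotomicExtension {p} L M],
      ∀ N : Submodule (ZMod p)[Gal(K/F)] (cycRep p E hG).asModule,
        IsKummerExtOf p M ((fun x => ((cycRep p E hG).asModuleEquiv x : PowerClasses p E)) ''
          (N : Set (cycRep p E hG).asModule)) →
        Nonempty (N ≃ₗ[(ZMod p)[Gal(K/F)]] (Fin k → (ZMod p)[Gal(K/F)])) →
        Nonempty (Gal(L/F) ≃* FreeSemidirect p k Gal(K/F))) ∧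
    -- `char K = p`: `J = K / ℘(K)` and `L = K(ρ(γ) : γ ∈ N)`
    (∀ [CharP K p], ∀ N : Submodule (ZMod p)[Gal(K/F)] (asRep p F K).asModule,
        IsASExtOf p L ((asRep p F K).asModuleEquiv '' (N : Set (asRep p F K).asModule)) →
        Nonempty (N ≃ₗ[(ZMod p)[Gal(K/F)]] (Fin k → (ZMod p)[Gal(K/F)])) →
        Nonempty (Gal(L/F) ≃* FreeSemidirect p k Gal(K/F))) := by
  have hpow := hL.pow_eq_one_of_mulEquiv hG
  refine ⟨?_, ?_, ?_⟩
  · rintro ⟨ξ, hξ⟩ N hN ⟨e⟩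
    have : IsCyclotomicExtension {p} K K := IsCyclotomicExtension.self_of_isPrimitiveRoot hξ
    have : IsCyclotomicExtension {p} L L := IsCyclotomicExtension.self_of_isPrimitiveRoot
      (hξ.map_of_injective (algebraMap K L).injective)
    -- With `E = K` the lift of `g` can only be `g` itself, so its existence says that `g` fixes the
    -- `p`-th roots of unity.
    have hfix : ∀ g : Gal(K/F), ExtendsFixingRoots p K g g := fun g => by
      obtain ⟨h, hh⟩ := exists_extendsFixingRoots p K hG g
      have : h = g := AlgEquiv.ext hh.1
      rwa [this] at hh
    rw [← Representation.range_submoduleInclusion] at hN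
    exact nonempty_mulEquiv_freeSemidirect_of_isKummerExtOf hpow id hfix e _
      (Representation.submoduleInclusion_injective _ N)
      (Representation.submoduleInclusion_of_smul _ N) hN
  · intro _ E M _ _ _ _ _ _ _ _ _ _ _ _ N hN ⟨e⟩
    -- The statement gives `M` no `F`-algebra structure; the one through `K` is compatible with
    -- those through `L` and `E`.
    let : Algebra F M := ((algebraMap K M).comp (algebraMap F K)).toAlgebra
    have : IsScalarTower F K M := IsScalarTower.of_algebraMap_eq fun _ => rfl
    have : IsScalarTower F L M := IsScalarTower.of_algebraMap_eq fun x => by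
      rw [IsScalarTower.algebraMap_apply F K M, IsScalarTower.algebraMap_apply K L M,
        IsScalarTower.algebraMap_apply F K L]
    have : IsScalarTower F E M := IsScalarTower.of_algebraMap_eq fun x => by
      rw [IsScalarTower.algebraMap_apply F K M, IsScalarTower.algebraMap_apply K E M,
        IsScalarTower.algebraMap_apply F K E]
    refine nonempty_mulEquiv_freeSemidirect_of_isKummerExtOf (M := M) hpow (cycLift p E hG)
      (cycLift_spec p E hG) e
      ((cycSpace p K E).subtype.toAddMonoidHom.comp ((cycRep p E hG).submoduleInclusion N))
      (Subtype.val_injective.comp (Representation.submoduleInclusion_injective _ N))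
      (fun g γ => congrArg Subtype.val (Representation.submoduleInclusion_of_smul _ N g γ)) ?_
    convert hN using 1
    rw [AddMonoidHom.coe_comp, Set.range_comp, Representation.range_submoduleInclusion,
      Set.image_image]
    rfl
  · intro _ N hN ⟨e⟩
    rw [← Representation.range_submoduleInclusion] at hN
    exact nonempty_mulEquiv_freeSemidirect_of_isASExtOf e _
      (Representation.submoduleInclusion_injective _ N)
      (Representation.submoduleInclusion_of_smul _ N) hN
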